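/- Let $K$ be a field and $S=K[x_1,\dots,x_n]$. A *Stanley decomposition* of a nonzero monomial ideal $I\subset S$ is a finite decomposition $I=\bigoplus_{k=1}^r u_kK[Z_k]$ of $K$-vector spaces, where each $u_k\in I$ is a nonzero scalar multiple of a monomial and $Z_k\subset\{x_1,\dots,x_n\}$; its Stanley depth is $\min_k|Z_k|$, and $\mathrm{sdepth}(I)$ is the maximum of the Stanley depths of all Stanley decompositions of $I$. **Theorem.** Let $m\ge 0$, let $n\ge n_0>n_1>\cdots>n_m\ge 1$ be integers, and let $a_{ij}$ ($0\le i\le m$, $1\le j\le n_i$) be positive integers such that $a_{ij}\ge a_{i+1,j}$ for all $0\le i<m$ and $1\le j\le n_{i+1}$. Put $Q_i=(x_1^{a_{i1}},\dots,x_{n_i}^{a_{in_i}})\subset S$ and $I_i=\bigcap_{j=i}^m Q_j$ for $0\le i\le m$. Then for every $0\le i\le m$ $$\mathrm{sdepth}(I_i)\ \ge\ n+\left\lceil \frac{n_m}{2}\right\rceil-n_i ,$$ and for every $0\le i\le m$ such that $Q_i$ is irredundant in the intersection $Q_0\cap\dots\cap Q_m$, i.e. $\bigcap_{j\ne i}Q_j\not\subset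 Q_i$, $$\mathrm{sdepth}(I_i)\ \le\ n-\left\lfloor \frac{n_i}{2}\right\rfloor .$$ In particular, if the decomposition $Q_0\cap\dots\cap Q_m$ is irredundant, both bounds hold for all $0\le i\le m$. Both bounds are sharp: for $n=5$ and $Q_1=(x_1,x_2,x_3,x_4)$, the ideal $I_0=(x_1^3,x_2^2,x_3^2,x_4,x_5)\cap Q_1$ has $\mathrm{sdepth}(I_0)=2=n+\lceil n_1/2\rceil-n_0$, and the ideal $I_0=(x_1^2,x_2^2,x_3,x_4,x_5)\cap Q_1$ has $\mathrm{sdepth}(I_0)=3=n-\lfloor n_0/2\rfloor$. -/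

import Mathlib

/-- The subspace `u K[Z]` of `K[x_1, …, x_n]`, where `K[Z]` is the polynomial subring in the
variables indexed by `Z`. -/
noncomputable def stanleySpace (K : Type*) [Field K] {n : ℕ}
    (u : MvPolynomial (Fin n) K) (Z : Finset (Fin n)) : Submodule K (MvPolynomial (Fin n) K) :=
  (Subalgebra.toSubmodule (MvPolynomial.supported K (Z : Set (Fin n)))).map (LinearMap.mulLeft K u)

/-- A Stanley decomposition of an ideal `I` of `K[x_1, …, x_n]`: a finite decomposition
`I = ⨁ u_i K[Z_i]` of `K`-vector spaces, where every `u_i` is a nonzero `ℤ^n`-homogeneous element,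
that is, a nonzero scalar times a monomial (so that `u_i K[Z_i]` is free over `K[Z_i]`). -/
structure StanleyDecomposition {K : Type*} [Field K] {n : ℕ}
    (I : Ideal (MvPolynomial (Fin n) K)) where
  /-- the number of summands -/
  size : ℕ
  /-- the homogeneous elements `u_i` -/
  gen : Fin size → MvPolynomial (Fin n) K
  /-- the sets of variables `Z_i` -/
  vars : Fin size → Finset (Fin n)
  homogeneous : ∀ i, ∃ (d : Fin n →₀ ℕ) (c : K), c ≠ 0 ∧ gen i = MvPolynomial.monomial d c
  indep : iSupIndep fun i => stanleySpace K (gen i) (vars i)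
  iSup_eq : ⨆ i, stanleySpace K (gen i) (vars i) = I.restrictScalars K

/-- The Stanley depth of a decomposition: the least `|Z_i|`. -/
noncomputable def StanleyDecomposition.sdepth {K : Type*} [Field K] {n : ℕ}
    {I : Ideal (MvPolynomial (Fin n) K)} (D : StanleyDecomposition I) : ℕ :=
  ⨅ i, (D.vars i).card

/-- The Stanley depth of a nonzero monomial ideal: the largest Stanley depth of its Stanley
decompositions (all of these are at most `n`, so the supremum is a maximum). -/
noncomputable def sdepth {K : Type*} [Field K] {n : ℕ} (I : Ideal (MvPolynomial (Fin n) K)) : ℕ :=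
  sSup {k | ∃ D : StanleyDecomposition I, D.sdepth = k}

/-- The monomial irreducible ideal `(x_1 ^ a_1, …, x_r ^ a_r)` of `K[x_1, …, x_n]`; the variable
`x_j` of the usual numbering is `X (j - 1)`. -/
noncomputable def powerIdeal (K : Type*) [Field K] {n : ℕ} (r : ℕ) (a : Fin n → ℕ) :
    Ideal (MvPolynomial (Fin n) K) :=
  Ideal.span {p | ∃ j : Fin n, (j : ℕ) < r ∧ p = MvPolynomial.X j ^ a j}

/-- The ideal `I_i = Q_i ∩ Q_{i+1} ∩ … ∩ Q_m`, where
`Q_j = (x_1 ^ a_{j,1}, …, x_{n_j} ^ a_{j,n_j})` and `n_j` is `ν j`. -/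
noncomputable def tailIdeal (K : Type*) [Field K] {n m : ℕ} (ν : Fin (m + 1) → ℕ)
    (a : Fin (m + 1) → Fin n → ℕ) (i : Fin (m + 1)) : Ideal (MvPolynomial (Fin n) K) :=
  ⨅ j, ⨅ (_ : i ≤ j), powerIdeal K (ν j) (a j)

/-! A Stanley decomposition of a monomial ideal is the same thing as a partition of its exponent set
into finitely many boxes, so everything reduces to combinatorics in `ℕ^n`.

Lower bound. For one irreducible ideal on a set `W` of variables, sort the exponents `e` by the
nonempty set `T` of those `j ∈ W` with `a j ≤ e j`. If `|W|` is odd, arrange `W` in a cycle `f`; the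
nonempty subsets of `W` are partitioned by the intervals `[f.core B, B]`, where `B` runs over the
sets meeting every pair `x, f x`. Such a `B` has at least `(|W| + 1) / 2` elements, and its piece
splits into boxes unbounded along `B`. For even `|W|` one variable is split off. A chain of ideals
is handled by induction (`BoxPartition.chain`): either the first condition holds at a variable
outside the second set, or it implies the second condition and the two merge.

Upper bound (`sdepth_le_of_update_mem`). Irredundance gives a monomial outside the ideal that enters
it when any one of `ν i` exponents is raised suitably. Two boxes containing such raised points
cannot each be free in the other's raised direction, so averaging over pairs produces a small box.

Sharpness. One example has an explicit partition into boxes with three free directions; in the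
other, such a partition is excluded by a weight certificate in the sense of linear programming
duality. -/

/-- The exponent vectors of the monomials in `x ^ c K[Z]`. -/
def stanleyBox {σ : Type*} (b : (σ → ℕ) × Finset σ) : Set (σ → ℕ) :=
  {e | ∀ j, b.1 j ≤ e j ∧ (j ∉ b.2 → e j = b.1 j)}

/-- `M` is a finite disjoint union of boxes which are unconstrained in the coordinates outside
`W` and are unbounded in at least `k` coordinates of `W`. -/
def BoxPartition {σ : Type*} [DecidableEq σ] (W : Finset σ) (k : ℕ) (M : Set (σ → ℕ)) : Prop :=
  ∃ F : Finset ((σ → ℕ) × Finset σ),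
    (∀ b ∈ F, (∀ j ∉ W, b.1 j = 0 ∧ j ∈ b.2) ∧ k ≤ (b.2 ∩ W).card) ∧
    (∀ e, e ∈ M ↔ ∃ b ∈ F, e ∈ stanleyBox b) ∧
    (∀ b ∈ F, ∀ b' ∈ F, ∀ e, e ∈ stanleyBox b → e ∈ stanleyBox b' → b = b')

/-! ### Unions, products and basic pieces of box partitions. -/

namespace BoxPartition

variable {σ : Type*} [DecidableEq σ] {W W₁ W₂ : Finset σ} {k k₁ k₂ : ℕ} {M M₁ M₂ : Set (σ → ℕ)}

theorem mono (h : BoxPartition W k₁ M) (hk : k₂ ≤ k₁) : BoxPartition W k₂ M := by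
  obtain ⟨F, h1, h2, h3⟩ := h
  exact ⟨F, fun b hb => ⟨(h1 b hb).1, hk.trans (h1 b hb).2⟩, h2, h3⟩

theorem empty : BoxPartition W k (∅ : Set (σ → ℕ)) :=
  ⟨∅, by simp, by simp, by simp⟩

theorem union (h₁ : BoxPartition W k M₁) (h₂ : BoxPartition W k M₂) (hd : Disjoint M₁ M₂) :
    BoxPartition W k (M₁ ∪ M₂) := by
  classical
  obtain ⟨F, a1, a2, a3⟩ := h₁
  obtain ⟨G, b1, b2, b3⟩ := h₂
  rw [Set.disjoint_left] at hd
  refine ⟨F ∪ G, ?_, ?_, ?_⟩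
  · intro b hb
    rcases Finset.mem_union.1 hb with hb | hb
    exacts [a1 b hb, b1 b hb]
  · intro e
    rw [Set.mem_union, a2, b2]
    simp only [Finset.mem_union]
    constructor
    · rintro (⟨b, hb, h⟩ | ⟨b, hb, h⟩)
      exacts [⟨b, .inl hb, h⟩, ⟨b, .inr hb, h⟩]
    · rintro ⟨b, hb | hb, h⟩
      exacts [.inl ⟨b, hb, h⟩, .inr ⟨b, hb, h⟩]
  · intro b hb b' hb' e he he'
    rcases Finset.mem_union.1 hb with hb | hb <;> rcases Finset.mem_union.1 hb' with hb' | hb'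
    · exact a3 b hb b' hb' e he he'
    · exact (hd ((a2 e).2 ⟨b, hb, he⟩) ((b2 e).2 ⟨b', hb', he'⟩)).elim
    · exact (hd ((a2 e).2 ⟨b', hb', he'⟩) ((b2 e).2 ⟨b, hb, he⟩)).elim
    · exact b3 b hb b' hb' e he he'

theorem biUnion {ι : Type*} (s : Finset ι) (M : ι → Set (σ → ℕ))
    (h : ∀ i ∈ s, BoxPartition W k (M i))
    (hd : ∀ i ∈ s, ∀ j ∈ s, ∀ e, e ∈ M i → e ∈ M j → i = j) :
    BoxPartition W k {e | ∃ i ∈ s, e ∈ M i} := by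
  classical
  induction s using Finset.induction_on with
  | empty => simpa using empty
  | insert i s hi ih =>
    have h1 := ih (fun j hj => h j (Finset.mem_insert_of_mem hj))
      (fun j hj l hl => hd j (Finset.mem_insert_of_mem hj) l (Finset.mem_insert_of_mem hl))
    have h2 := (h i (Finset.mem_insert_self i s)).union h1 (by
      rw [Set.disjoint_left]
      rintro e he ⟨j, hj, hej⟩
      exact hi (hd i (Finset.mem_insert_self i s) j (Finset.mem_insert_of_mem hj) e he hej ▸ hj))
    convert h2 using 1
    ext e
    simp

/-- In each coordinate at least one of the two boxes imposes nothing (corner `0`, free), so adding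
corners and intersecting free sets retains exactly the other's constraint. -/
theorem mem_stanleyBox_add {b b' : (σ → ℕ) × Finset σ} (hW : Disjoint W₁ W₂)
    (hb : ∀ j ∉ W₁, b.1 j = 0 ∧ j ∈ b.2) (hb' : ∀ j ∉ W₂, b'.1 j = 0 ∧ j ∈ b'.2) (e : σ → ℕ) :
    e ∈ stanleyBox (b.1 + b'.1, b.2 ∩ b'.2) ↔ e ∈ stanleyBox b ∧ e ∈ stanleyBox b' := by
  rw [Finset.disjoint_left] at hW
  simp only [stanleyBox, Set.mem_ofPred_eq, Pi.add_apply, Finset.mem_inter, ← forall_and]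
  refine forall_congr' fun j => ?_
  have h1 := @hW j
  have h2 := hb j
  have h3 := hb' j
  by_cases j1 : j ∈ W₁
  · obtain ⟨h4, h5⟩ := h3 (h1 j1)
    simp [h4, h5]
  · obtain ⟨h4, h5⟩ := h2 j1
    simp [h4, h5]

theorem inter (h₁ : BoxPartition W₁ k₁ M₁) (h₂ : BoxPartition W₂ k₂ M₂) (hW : Disjoint W₁ W₂) :
    BoxPartition (W₁ ∪ W₂) (k₁ + k₂) (M₁ ∩ M₂) := by
  classical
  obtain ⟨F, a1, a2, a3⟩ := h₁
  obtain ⟨G, b1, b2, b3⟩ := h₂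
  refine ⟨(F ×ˢ G).image fun p => (p.1.1 + p.2.1, p.1.2 ∩ p.2.2), ?_, ?_, ?_⟩
  · simp only [Finset.mem_image, Finset.mem_product, Prod.exists]
    rintro _ ⟨c, Z, c', Z', ⟨hb, hb'⟩, rfl⟩
    obtain ⟨u1, u2⟩ := a1 _ hb
    obtain ⟨v1, v2⟩ := b1 _ hb'
    rw [Finset.disjoint_left] at hW
    refine ⟨fun j hj => ?_, ?_⟩
    · simp only [Finset.mem_union, not_or] at hj
      have := u1 j hj.1
      have := v1 j hj.2
      simp_all
    · have hsub : (Z ∩ W₁) ∪ (Z' ∩ W₂) ⊆ (Z ∩ Z') ∩ (W₁ ∪ W₂) := by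
        intro j hj
        simp only [Finset.mem_union, Finset.mem_inter] at hj ⊢
        rcases hj with ⟨p, q⟩ | ⟨p, q⟩
        · exact ⟨⟨p, (v1 j (hW q)).2⟩, .inl q⟩
        · exact ⟨⟨(u1 j fun h => hW h q).2, p⟩, .inr q⟩
      refine le_trans ?_ (Finset.card_le_card hsub)
      rw [Finset.card_union_of_disjoint]
      · exact add_le_add u2 v2
      · rw [Finset.disjoint_left]
        intro j hj hj'
        exact hW (Finset.mem_inter.1 hj).2 (Finset.mem_inter.1 hj').2
  · intro e
    rw [Set.mem_inter_iff, a2, b2]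
    constructor
    · rintro ⟨⟨b, hb, h⟩, b', hb', h'⟩
      exact ⟨_, Finset.mem_image.2 ⟨(b, b'), Finset.mem_product.2 ⟨hb, hb'⟩, rfl⟩,
        (mem_stanleyBox_add hW (a1 b hb).1 (b1 b' hb').1 e).2 ⟨h, h'⟩⟩
    · rintro ⟨_, hp, h⟩
      obtain ⟨⟨b, b'⟩, hbb, rfl⟩ := Finset.mem_image.1 hp
      obtain ⟨hb, hb'⟩ := Finset.mem_product.1 hbb
      obtain ⟨h, h'⟩ := (mem_stanleyBox_add hW (a1 b hb).1 (b1 b' hb').1 e).1 h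
      exact ⟨⟨b, hb, h⟩, b', hb', h'⟩
  · intro p hp q hq e he he'
    obtain ⟨⟨b, b'⟩, hbb, rfl⟩ := Finset.mem_image.1 hp
    obtain ⟨⟨d, d'⟩, hdd, rfl⟩ := Finset.mem_image.1 hq
    obtain ⟨hb, hb'⟩ := Finset.mem_product.1 hbb
    obtain ⟨hd, hd'⟩ := Finset.mem_product.1 hdd
    obtain ⟨h1, h2⟩ := (mem_stanleyBox_add hW (a1 b hb).1 (b1 b' hb').1 e).1 he
    obtain ⟨h3, h4⟩ := (mem_stanleyBox_add hW (a1 d hd).1 (b1 d' hd').1 e).1 he'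
    rw [a3 b hb d hd e h1 h3, b3 b' hb' d' hd' e h2 h4]

theorem forall_ge [Fintype σ] {A : Finset σ} (hA : A ⊆ W) (a : σ → ℕ) :
    BoxPartition W W.card {e | ∀ j ∈ A, a j ≤ e j} := by
  refine ⟨{(fun j => if j ∈ A then a j else 0, Finset.univ)}, ?_, ?_, ?_⟩
  · simp only [Finset.mem_singleton, forall_eq, Finset.mem_univ, and_true, Finset.univ_inter,
      le_refl, ite_eq_right_iff]
    exact fun j hj hj' => (hj (hA hj')).elim
  · intro e
    simp only [Set.mem_ofPred_eq, Finset.mem_singleton, exists_eq_left, stanleyBox,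
      Finset.mem_univ, not_true_eq_false, IsEmpty.forall_iff, and_true]
    refine forall_congr' fun j => ?_
    split_ifs with h <;> simp [h]
  · simp +contextual

/-- One box for each of the finitely many possible restrictions to `W`; no coordinate of `W` stays
free. -/
theorem forall_lt [Fintype σ] (W : Finset σ) (a : σ → ℕ) :
    BoxPartition W 0 {e | ∀ j ∈ W, e j < a j} := by
  classical
  refine ⟨(Fintype.piFinset fun j => if j ∈ W then Finset.range (a j) else {0}).image
    fun d => (d, Wᶜ), ?_, ?_, ?_⟩
  · simp only [Finset.mem_image, Fintype.mem_piFinset]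
    rintro _ ⟨d, hd, rfl⟩
    refine ⟨fun j hj => ⟨?_, by simpa using hj⟩, Nat.zero_le _⟩
    simpa [hj] using hd j
  · intro e
    simp only [Set.mem_ofPred_eq, Finset.mem_image, Fintype.mem_piFinset]
    constructor
    · intro h
      refine ⟨_, ⟨fun j => if j ∈ W then e j else 0, fun j => ?_, rfl⟩, fun j => ?_⟩
      · by_cases hj : j ∈ W <;> simp [hj, h]
      · by_cases hj : j ∈ W <;> simp [hj]
    · rintro ⟨_, ⟨d, hd, rfl⟩, he⟩ j hj
      have h1 := hd j
      have h2 := (he j).2 (by simpa using hj)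
      simp only [hj, if_true, Finset.mem_range] at h1
      simpa [h2] using h1
  · intro p hp q hq e he he'
    obtain ⟨d, hd, rfl⟩ := Finset.mem_image.1 hp
    obtain ⟨d', hd', rfl⟩ := Finset.mem_image.1 hq
    rw [Fintype.mem_piFinset] at hd hd'
    suffices d = d' by rw [this]
    ext j
    by_cases hj : j ∈ W
    · have h2 := (he j).2 (by simpa using hj)
      have h3 := (he' j).2 (by simpa using hj)
      exact h2.symm.trans h3
    · have h2 := hd j
      have h3 := hd' j
      simp only [hj, if_false, Finset.mem_singleton] at h2 h3
      rw [h2, h3]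

end BoxPartition

/-! ### Partitioning the nonempty subsets of a cycle into intervals. -/

/-- The elements `x` of `B` with `f x ∈ B`. -/
def Equiv.Perm.core {σ : Type*} [DecidableEq σ] (f : Equiv.Perm σ) (B : Finset σ) : Finset σ :=
  B.filter fun x => f x ∈ B

/-- The subsets of `W` whose complement in `W` contains no pair `x, f x`. -/
def Equiv.Perm.coverings {σ : Type*} [DecidableEq σ] (f : Equiv.Perm σ) (W : Finset σ) :
    Finset (Finset σ) :=
  W.powerset.filter fun B => ∀ x ∈ W, x ∈ B ∨ f x ∈ B

theorem Equiv.Perm.mem_coverings {σ : Type*} [DecidableEq σ] {f : Equiv.Perm σ} {W B : Finset σ} :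
    B ∈ f.coverings W ↔ B ⊆ W ∧ ∀ x ∈ W, x ∈ B ∨ f x ∈ B := by
  rw [Equiv.Perm.coverings, Finset.mem_filter, Finset.mem_powerset]

namespace Equiv.Perm.IsCycleOn

variable {σ : Type*} [DecidableEq σ] {f : Equiv.Perm σ} {W E B B' : Finset σ}

/-- `f` injects `W \ B` into `B`, and parity excludes equality. -/
theorem card_lt_two_mul_card (hW : Odd W.card) (hB : B ∈ f.coverings W) :
    W.card + 1 ≤ 2 * B.card := by
  rw [Equiv.Perm.mem_coverings] at hB
  have h1 : (W \ B).card ≤ B.card := by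
    refine Finset.card_le_card_of_injOn f (fun x hx => ?_) f.injective.injOn
    have hx := Finset.mem_sdiff.1 hx
    exact (hB.2 x hx.1).resolve_left hx.2
  have h2 := Finset.card_sdiff_add_card_eq_card hB.1
  obtain ⟨t, ht⟩ := hW
  omega

/-- With an empty core, `f` would also inject `B` into `W \ B`, which is too small. Hence no
interval contains the empty set. -/
theorem core_nonempty (hf : f.IsCycleOn W) (hW : Odd W.card) (hB : B ∈ f.coverings W) :
    (f.core B).Nonempty := by
  by_contra h
  rw [Finset.not_nonempty_iff_eq_empty, Equiv.Perm.core, Finset.filter_eq_empty_iff] at h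
  have h3 := card_lt_two_mul_card hW hB
  rw [Equiv.Perm.mem_coverings] at hB
  have h1 : B.card ≤ (W \ B).card := by
    refine Finset.card_le_card_of_injOn f (fun x hx => ?_) f.injective.injOn
    exact Finset.mem_sdiff.2 ⟨hf.apply_mem_iff.2 (hB.1 hx), h hx⟩
  have h2 := Finset.card_sdiff_add_card_eq_card hB.1
  omega

/-- Such a `B` satisfies `x ∈ B ↔ x ∈ E ∨ f x ∉ B` on `W`. This recursion determines `B` by walking
backwards along the cycle from a point of `E`. -/
theorem covering_unique (hf : f.IsCycleOn W) (hEW : E ⊆ W) (hE : E.Nonempty)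
    (hB : B ∈ f.coverings W) (hB' : B' ∈ f.coverings W)
    (h1 : f.core B ⊆ E) (h2 : E ⊆ B) (h1' : f.core B' ⊆ E) (h2' : E ⊆ B') : B = B' := by
  have key : ∀ C ∈ f.coverings W, f.core C ⊆ E → E ⊆ C →
      ∀ x ∈ W, (x ∈ C ↔ x ∈ E ∨ f x ∉ C) := by
    intro C hC a1 a2 x hx
    rw [Equiv.Perm.mem_coverings] at hC
    have := hC.2 x hx
    have h3 : x ∈ C → f x ∈ C → x ∈ E := fun p q => a1 (Finset.mem_filter.2 ⟨p, q⟩)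
    have h4 := @a2 x
    tauto
  have key2 : ∀ j : ℕ, ∀ x ∈ W, (f ^ j) x ∈ E → (x ∈ B ↔ x ∈ B') := by
    intro j
    induction j with
    | zero => exact fun x _ hx => ⟨fun _ => h2' hx, fun _ => h2 hx⟩
    | succ j ih =>
      intro x hx hj
      rw [pow_succ, Equiv.Perm.mul_apply] at hj
      rw [key B hB h1 h2 x hx, key B' hB' h1' h2' x hx, ih (f x) (hf.apply_mem_iff.2 hx) hj]
  obtain ⟨y, hy⟩ := hE
  have hBW := (Equiv.Perm.mem_coverings.1 hB).1
  have hBW' := (Equiv.Perm.mem_coverings.1 hB').1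
  have key3 : ∀ x ∈ W, (x ∈ B ↔ x ∈ B') := by
    intro x hx
    obtain ⟨j, -, hj⟩ := hf.exists_pow_eq hx (hEW hy)
    exact key2 j x hx (hj ▸ hy)
  ext x
  exact ⟨fun h => (key3 x (hBW h)).1 h, fun h => (key3 x (hBW' h)).2 h⟩

/-- Take the points whose number of steps along `f` to reach `E` is even: off `E` each step lowers
this number by one, so parities alternate there. -/
theorem exists_covering (hf : f.IsCycleOn W) (hEW : E ⊆ W) (hE : E.Nonempty) :
    ∃ B ∈ f.coverings W, f.core B ⊆ E ∧ E ⊆ B := by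
  classical
  obtain ⟨y, hy⟩ := hE
  let D : σ → ℕ := fun x => sInf {j | (f ^ j) x ∈ E}
  have hne : ∀ x ∈ W, {j | (f ^ j) x ∈ E}.Nonempty := by
    intro x hx
    obtain ⟨j, -, hj⟩ := hf.exists_pow_eq hx (hEW hy)
    exact ⟨j, by simpa [hj] using hy⟩
  have hmem : ∀ x ∈ W, (f ^ D x) x ∈ E := fun x hx => Nat.sInf_mem (hne x hx)
  have hle : ∀ x j, (f ^ j) x ∈ E → D x ≤ j := fun x j hj => Nat.sInf_le hj
  have hD0 : ∀ x ∈ E, D x = 0 := fun x hx => Nat.le_zero.1 (hle x 0 (by simpa using hx))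
  have hDs : ∀ x ∈ W, x ∉ E → D x = D (f x) + 1 := by
    intro x hx hxE
    refine le_antisymm (hle x _ ?_) ?_
    · rw [pow_succ, Equiv.Perm.mul_apply]
      exact hmem (f x) (hf.apply_mem_iff.2 hx)
    · have h := hmem x hx
      rcases hd : D x with _ | d
      · rw [hd] at h
        exact (hxE (by simpa using h)).elim
      · rw [hd, pow_succ, Equiv.Perm.mul_apply] at h
        exact Nat.succ_le_succ (hle (f x) d h)
  refine ⟨W.filter fun x => Even (D x), ?_, ?_, ?_⟩
  · rw [Equiv.Perm.mem_coverings]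
    refine ⟨Finset.filter_subset _ _, fun x hx => ?_⟩
    simp only [Finset.mem_filter]
    by_cases hxE : x ∈ E
    · exact .inl ⟨hx, by simp [hD0 x hxE]⟩
    · have := hDs x hx hxE
      rcases Nat.even_or_odd (D x) with h | h
      · exact .inl ⟨hx, h⟩
      · refine .inr ⟨hf.apply_mem_iff.2 hx, ?_⟩
        rw [this] at h
        grind
  · intro x hx
    simp only [Equiv.Perm.core, Finset.mem_filter] at hx
    by_contra hxE
    have := hDs x hx.1.1 hxE
    have h1 := hx.1.2
    have h2 := hx.2.2
    grind
  · intro x hx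
    exact Finset.mem_filter.2 ⟨hEW hx, by simp [hD0 x hx]⟩

end Equiv.Perm.IsCycleOn

/-! ### Box partitions for one irreducible ideal and for a chain of them. -/

namespace BoxPartition

variable {σ : Type*} [DecidableEq σ] [Fintype σ]

theorem exists_le_of_odd {W : Finset σ} (hW : Odd W.card) (a : σ → ℕ) :
    BoxPartition W ((W.card + 1) / 2) {e | ∃ j ∈ W, a j ≤ e j} := by
  classical
  obtain ⟨f, hf, -⟩ := W.exists_cycleOn
  -- The piece of `B` leaves the coordinates in `B \ f.core B` unconstrained, hence corresponds to
  -- an interval of sets.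
  have key : ∀ e : σ → ℕ, ∀ B ∈ f.coverings W,
      (e ∈ {e : σ → ℕ | ∀ j ∈ f.core B, a j ≤ e j} ∩ {e | ∀ j ∈ W \ B, e j < a j} ↔
        f.core B ⊆ W.filter (fun j => a j ≤ e j) ∧ W.filter (fun j => a j ≤ e j) ⊆ B) := by
    intro e B hB
    have hBW := (Equiv.Perm.mem_coverings.1 hB).1
    have hAB : f.core B ⊆ B := Finset.filter_subset _ _
    simp only [Set.mem_inter_iff, Set.mem_ofPred_eq, Finset.subset_iff, Finset.mem_filter,
      Finset.mem_sdiff]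
    refine and_congr ⟨fun h j hj => ⟨hBW (hAB hj), h j hj⟩, fun h j hj => (h hj).2⟩ ?_
    refine forall_congr' fun j => ?_
    rw [← not_le]
    tauto
  have h := biUnion (W := W) (k := (W.card + 1) / 2) (f.coverings W)
    (fun B => {e : σ → ℕ | ∀ j ∈ f.core B, a j ≤ e j} ∩ {e | ∀ j ∈ W \ B, e j < a j}) ?_ ?_
  · convert h using 1
    ext e
    simp only [Set.mem_ofPred_eq]
    constructor
    · rintro ⟨j, hj, hje⟩
      obtain ⟨B, hB, h1⟩ := hf.exists_covering (Finset.filter_subset (fun j => a j ≤ e j) W)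
        ⟨j, Finset.mem_filter.2 ⟨hj, hje⟩⟩
      exact ⟨B, hB, (key e B hB).2 h1⟩
    · rintro ⟨B, hB, he⟩
      obtain ⟨j, hj⟩ := hf.core_nonempty hW hB
      have := Finset.mem_filter.1 (((key e B hB).1 he).1 hj)
      exact ⟨j, this⟩
  · intro B hB
    have hBW := (Equiv.Perm.mem_coverings.1 hB).1
    have h1 := (forall_ge (Finset.filter_subset (fun x => f x ∈ B) B) a).inter
      (forall_lt (W \ B) a) Finset.disjoint_sdiff
    rw [Finset.union_sdiff_of_subset hBW] at h1
    refine h1.mono ?_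
    have := Equiv.Perm.IsCycleOn.card_lt_two_mul_card hW hB
    omega
  · intro B hB B' hB' e he he'
    have h1 := (key e B hB).1 he
    have h2 := (key e B' hB').1 he'
    refine hf.covering_unique (Finset.filter_subset (fun j => a j ≤ e j) W) ?_ hB hB'
      h1.1 h1.2 h2.1 h2.2
    exact (hf.core_nonempty hW hB).mono h1.1

theorem univ (W : Finset σ) : BoxPartition W W.card (Set.univ : Set (σ → ℕ)) := by
  simpa using forall_ge (Finset.empty_subset W) (fun _ => 0)

/-- For even `|W|`, split according to `a w ≤ e w` for one `w`: if it holds, nothing else is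
required; if not, the odd case on `W.erase w` still gives `|W| / 2` free directions. -/
theorem exists_le (W : Finset σ) (a : σ → ℕ) :
    BoxPartition W ((W.card + 1) / 2) {e | ∃ j ∈ W, a j ≤ e j} := by
  rcases Nat.even_or_odd W.card with h | h
  · rcases W.eq_empty_or_nonempty with rfl | ⟨w, hw⟩
    · simpa using empty
    have hc := Finset.card_erase_add_one hw
    have hd : Disjoint {w} (W.erase w) := by simp
    have hu : {w} ∪ W.erase w = W := by
      rw [← Finset.insert_eq, Finset.insert_erase hw]
    have ho : Odd (W.erase w).card := by grind
    have h1 := (forall_ge (Finset.Subset.refl {w}) a).inter (univ (W.erase w)) hd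
    have h2 := (forall_lt {w} a).inter (exists_le_of_odd ho a) hd
    rw [hu] at h1 h2
    have h3 := (h1.mono (k₂ := (W.card + 1) / 2) (by simp; omega)).union
      (h2.mono (k₂ := (W.card + 1) / 2) (by obtain ⟨t, ht⟩ := h; omega)) (by
        rw [Set.disjoint_left]
        rintro e ⟨h, -⟩ ⟨h', -⟩
        simp at h h'
        omega)
    convert h3 using 1
    ext e
    simp only [Set.mem_ofPred_eq, Set.mem_union, Set.mem_inter_iff, Finset.mem_singleton,
      forall_eq, Set.mem_univ, and_true, Finset.mem_erase]
    constructor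
    · rintro ⟨j, hj, hje⟩
      by_cases h : a w ≤ e w
      · exact .inl h
      · exact .inr ⟨by omega, j, ⟨fun h' => h (h' ▸ hje), hj⟩, hje⟩
    · rintro (h | ⟨-, j, ⟨-, hj⟩, hje⟩)
      exacts [⟨w, hw, h⟩, ⟨j, hj, hje⟩]
  · exact exists_le_of_odd h a

/-- The exponent sets of intersections of the ideals `(x_j ^ a_{ij} : j ∈ W i)` for a decreasing
chain of sets `W i` and exponents which decrease with `i`. -/
theorem chain (m : ℕ) (W : ℕ → Finset σ) (a : ℕ → σ → ℕ)
    (hW : ∀ i < m, W (i + 1) ⊆ W i) (ha : ∀ i < m, ∀ j ∈ W (i + 1), a (i + 1) j ≤ a i j) :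
    BoxPartition (W 0) (((W m).card + 1) / 2) {e | ∀ i ≤ m, ∃ j ∈ W i, a i j ≤ e j} := by
  classical
  induction m generalizing W a with
  | zero => simpa using exists_le (W 0) (a 0)
  | succ m ih =>
    have h10 := hW 0 (Nat.succ_pos m)
    have h1 := ih (fun i => W (i + 1)) (fun i => a (i + 1)) (fun i hi => hW (i + 1) (by omega))
      (fun i hi => ha (i + 1) (by omega))
    -- On `W 1` condition `0` implies condition `1`, because `a 1 ≤ a 0` there. So the merged chain
    -- starts with `W 1` and the exponents `a 0`.
    have h2 := ih (fun i => W (i + 1)) (fun i => if i = 0 then a 0 else a (i + 1))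
      (fun i hi => hW (i + 1) (by omega)) (fun i hi j hj => by
        simp only [Nat.succ_ne_zero, if_false]
        have h3 := ha (i + 1) (by omega) j hj
        split_ifs with h
        · subst h
          exact h3.trans (ha 0 (by omega) j (hW 1 (by omega) hj))
        · exact h3)
    -- Free directions in `W 0 \ W 1` are discarded, since the complementary piece `h4` has none
    -- there.
    have h3 := ((exists_le (W 0 \ W 1) (a 0)).mono (Nat.zero_le _)).inter h1 Finset.sdiff_disjoint
    have h4 := (forall_lt (W 0 \ W 1) (a 0)).inter h2 Finset.sdiff_disjoint
    rw [zero_add, zero_add, Finset.sdiff_union_of_subset h10] at h3 h4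
    have h5 := h3.union h4 (by
      rw [Set.disjoint_left]
      rintro e ⟨⟨j, hj, hje⟩, -⟩ ⟨h', -⟩
      exact absurd hje (not_le.2 (h' j hj)))
    convert h5 using 1
    ext e
    simp only [Set.mem_ofPred_eq, Set.mem_union, Set.mem_inter_iff]
    constructor
    · intro h
      by_cases hj : ∃ j ∈ W 0 \ W 1, a 0 j ≤ e j
      · exact .inl ⟨hj, fun i hi => h (i + 1) (by omega)⟩
      · refine .inr ⟨by simpa using hj, fun i hi => ?_⟩
        rcases i with _ | i
        · obtain ⟨j, hj0, hje⟩ := h 0 (by omega)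
          refine ⟨j, ?_, by simpa using hje⟩
          by_contra hj1
          exact hj ⟨j, Finset.mem_sdiff.2 ⟨hj0, hj1⟩, hje⟩
        · simpa using h (i + 1 + 1) (by omega)
    · rintro (⟨⟨j, hj, hje⟩, h⟩ | ⟨-, h⟩) i hi
      · rcases i with _ | i
        · exact ⟨j, (Finset.mem_sdiff.1 hj).1, hje⟩
        · exact h i (by omega)
      · obtain ⟨j, hj, hje⟩ := h 0 (by omega)
        simp only [if_true] at hje
        rcases i with _ | _ | i
        · exact ⟨j, h10 hj, hje⟩
        · exact ⟨j, hj, (ha 0 (by omega) j hj).trans hje⟩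
        · simpa using h (i + 1) (by omega)

end BoxPartition

/-! ### Stanley decompositions as partitions of exponent sets. -/

namespace MvPolynomial

variable {K : Type*} [Field K] {n : ℕ}

theorem stanleySpace_monomial (d : Fin n →₀ ℕ) {c : K} (hc : c ≠ 0) (Z : Finset (Fin n)) :
    stanleySpace K (monomial d c) Z =
      restrictSupport K {e : Fin n →₀ ℕ | ⇑e ∈ stanleyBox (⇑d, Z)} := by
  apply le_antisymm
  · rintro _ ⟨q, hq, rfl⟩
    have hq : q ∈ supported K (Z : Set (Fin n)) := hq
    rw [mem_supported] at hq
    rw [mem_restrictSupport_iff]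
    intro e he
    rw [Finset.mem_coe, mem_support_iff, LinearMap.mulLeft_apply, coeff_monomial_mul'] at he
    have hde : d ≤ e := by
      by_contra h
      simp [h] at he
    rw [if_pos hde] at he
    intro j
    refine ⟨hde j, fun hj => le_antisymm ?_ (hde j)⟩
    by_contra h
    refine hj (Finset.mem_coe.1 (hq (Finset.mem_coe.2 ?_)))
    rw [mem_vars_iff_mem_support]
    refine ⟨e - d, mem_support_iff.2 (right_ne_zero_of_mul he), ?_⟩
    rw [Finsupp.mem_support_iff, Finsupp.tsub_apply]
    change ¬ e j ≤ d j at h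
    omega
  · rw [restrictSupport_eq_span, Submodule.span_le]
    rintro _ ⟨e, he, rfl⟩
    have hde : d ≤ e := fun j => (he j).1
    refine ⟨monomial (e - d) c⁻¹, ?_, ?_⟩
    · change monomial (e - d) c⁻¹ ∈ supported K (Z : Set (Fin n))
      rw [mem_supported, vars_monomial (inv_ne_zero hc)]
      intro j hj
      rw [Finset.mem_coe, Finsupp.mem_support_iff, Finsupp.tsub_apply] at hj
      by_contra h
      have := (he j).2 h
      change e j = d j at this
      omega
    · rw [LinearMap.mulLeft_apply, monomial_mul, add_tsub_cancel_of_le hde, mul_inv_cancel₀ hc]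

/-- `M` is the set of exponent vectors of the monomials in the monomial ideal `I`. -/
def IsExponentSet (I : Ideal (MvPolynomial (Fin n) K)) (M : Set (Fin n → ℕ)) : Prop :=
  ∀ p, p ∈ I ↔ ∀ d ∈ p.support, ⇑d ∈ M

theorem IsExponentSet.restrictScalars_eq {I : Ideal (MvPolynomial (Fin n) K)}
    {M : Set (Fin n → ℕ)} (h : IsExponentSet I M) :
    I.restrictScalars K = restrictSupport K {e : Fin n →₀ ℕ | ⇑e ∈ M} := by
  ext p
  rw [Submodule.restrictScalars_mem, h, mem_restrictSupport_iff]
  rfl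

theorem isExponentSet_powerIdeal (r : ℕ) (a : Fin n → ℕ) :
    IsExponentSet (powerIdeal K r a) {e | ∃ j : Fin n, (j : ℕ) < r ∧ a j ≤ e j} := by
  intro p
  have : {p | ∃ j : Fin n, (j : ℕ) < r ∧ p = MvPolynomial.X j ^ a j} =
      (fun s => monomial s (1 : K)) '' {s | ∃ j : Fin n, (j : ℕ) < r ∧ s = Finsupp.single j (a j)} := by
    ext q
    simp only [X_pow_eq_monomial, Set.mem_image, Set.mem_ofPred_eq]
    constructor
    · rintro ⟨j, hj, rfl⟩
      exact ⟨_, ⟨j, hj, rfl⟩, rfl⟩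
    · rintro ⟨_, ⟨j, hj, rfl⟩, rfl⟩
      exact ⟨j, hj, rfl⟩
  rw [powerIdeal, this, mem_ideal_span_monomial_image]
  refine forall₂_congr fun d _ => ?_
  constructor
  · rintro ⟨_, ⟨j, hj, rfl⟩, h⟩
    exact ⟨j, hj, by simpa using h j⟩
  · rintro ⟨j, hj, h⟩
    exact ⟨_, ⟨j, hj, rfl⟩, by simpa using h⟩

theorem isExponentSet_iInf {ι : Type*} {P : ι → Prop} {I : ι → Ideal (MvPolynomial (Fin n) K)}
    {M : ι → Set (Fin n → ℕ)} (h : ∀ i, IsExponentSet (I i) (M i)) :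
    IsExponentSet (⨅ i, ⨅ (_ : P i), I i) {e | ∀ i, P i → e ∈ M i} := by
  intro p
  simp only [Submodule.mem_iInf, Set.mem_ofPred_eq]
  constructor
  · exact fun h1 d hd i hi => (h i p).1 (h1 i hi) d hd
  · exact fun h1 i hi => (h i p).2 fun d hd => h1 d hd i hi

theorem isExponentSet_tailIdeal {m : ℕ} (ν : Fin (m + 1) → ℕ) (a : Fin (m + 1) → Fin n → ℕ)
    (i : Fin (m + 1)) : IsExponentSet (tailIdeal K ν a i)
      {e | ∀ l, i ≤ l → ∃ j : Fin n, (j : ℕ) < ν l ∧ a l j ≤ e j} :=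
  isExponentSet_iInf fun l => isExponentSet_powerIdeal (ν l) (a l)

variable {I : Ideal (MvPolynomial (Fin n) K)} {M : Set (Fin n → ℕ)}

theorem exists_boxes (hM : IsExponentSet I M) (D : StanleyDecomposition I) :
    ∃ c : Fin D.size → Fin n → ℕ,
      (∀ e, e ∈ M ↔ ∃ i, e ∈ stanleyBox (c i, D.vars i)) ∧
      ∀ i i' e, e ∈ stanleyBox (c i, D.vars i) → e ∈ stanleyBox (c i', D.vars i') → i = i' := by
  choose d c hc hd using D.homogeneous
  have hS : ∀ i, stanleySpace K (D.gen i) (D.vars i) =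
      restrictSupport K {e : Fin n →₀ ℕ | ⇑e ∈ stanleyBox (⇑(d i), D.vars i)} := fun i => by
    rw [hd i, stanleySpace_monomial _ (hc i)]
  have hsup := D.iSup_eq
  have hind := D.indep
  simp only [hS] at hsup hind
  rw [hM.restrictScalars_eq] at hsup
  have hmon : ∀ (s : Set (Fin n →₀ ℕ)) (e : Fin n →₀ ℕ),
      monomial e (1 : K) ∈ restrictSupport K s ↔ e ∈ s := fun s e => by
    simp [monomial_mem_restrictSupport]
  refine ⟨fun i => ⇑(d i), fun e => ?_, fun i i' e he he' => ?_⟩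
  · obtain ⟨e, rfl⟩ : ∃ e' : Fin n →₀ ℕ, ⇑e' = e := ⟨Finsupp.equivFunOnFinite.symm e, rfl⟩
    constructor
    · intro he
      have h1 : monomial e (1 : K) ∈ restrictSupport K {e : Fin n →₀ ℕ | ⇑e ∈ M} :=
        (hmon _ e).2 he
      rw [← hsup] at h1
      have h2 : (⨆ i, restrictSupport K {e : Fin n →₀ ℕ | ⇑e ∈ stanleyBox (⇑(d i), D.vars i)}) ≤
          restrictSupport K {e : Fin n →₀ ℕ | ∃ i, ⇑e ∈ stanleyBox (⇑(d i), D.vars i)} :=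
        iSup_le fun i => restrictSupport_mono K fun e he => ⟨i, he⟩
      exact (hmon _ e).1 (h2 h1)
    · rintro ⟨i, hi⟩
      refine (hmon {e : Fin n →₀ ℕ | ⇑e ∈ M} e).1 ?_
      rw [← hsup]
      exact Submodule.mem_iSup_of_mem i ((hmon _ e).2 hi)
  · obtain ⟨e, rfl⟩ : ∃ e' : Fin n →₀ ℕ, ⇑e' = e := ⟨Finsupp.equivFunOnFinite.symm e, rfl⟩
    by_contra hne
    have h1 := Submodule.disjoint_def.1 (hind.pairwiseDisjoint hne) (monomial e 1)
      ((hmon _ e).2 he) ((hmon _ e).2 he')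
    simp at h1

theorem exists_stanleyDecomposition (hM : IsExponentSet I M) {N : ℕ} (c : Fin N → Fin n → ℕ)
    (Z : Fin N → Finset (Fin n)) (h1 : ∀ e, e ∈ M ↔ ∃ i, e ∈ stanleyBox (c i, Z i))
    (h2 : ∀ i i' e, e ∈ stanleyBox (c i, Z i) → e ∈ stanleyBox (c i', Z i') → i = i') :
    ∃ D : StanleyDecomposition I, ∃ h : D.size = N, ∀ i, D.vars i = Z (Fin.cast h i) := by
  let d : Fin N → Fin n →₀ ℕ := fun i => Finsupp.equivFunOnFinite.symm (c i)
  have hS : ∀ i, stanleySpace K (monomial (d i) (1 : K)) (Z i) =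
      restrictSupport K {e : Fin n →₀ ℕ | ⇑e ∈ stanleyBox (c i, Z i)} := fun i =>
    stanleySpace_monomial (d i) one_ne_zero (Z i)
  refine ⟨⟨N, fun i => monomial (d i) 1, Z, fun i => ⟨d i, 1, one_ne_zero, rfl⟩, ?_, ?_⟩,
    rfl, fun i => rfl⟩
  · simp only [hS]
    intro i
    have h3 : (⨆ j, ⨆ (_ : j ≠ i), restrictSupport K {e : Fin n →₀ ℕ | ⇑e ∈ stanleyBox (c j, Z j)})
        ≤ restrictSupport K {e : Fin n →₀ ℕ | ∃ j, j ≠ i ∧ ⇑e ∈ stanleyBox (c j, Z j)} :=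
      iSup₂_le fun j hj => restrictSupport_mono K fun e he => ⟨j, hj, he⟩
    refine Disjoint.mono_right h3 (Submodule.disjoint_def.2 fun p hp hp' => ?_)
    rw [mem_restrictSupport_iff] at hp hp'
    rw [← support_eq_empty, Finset.eq_empty_iff_forall_notMem]
    intro e he
    obtain ⟨j, hj, hej⟩ := hp' he
    exact hj (h2 j i _ hej (hp he))
  · simp only [hS]
    rw [hM.restrictScalars_eq]
    apply le_antisymm
    · exact iSup_le fun i => restrictSupport_mono K fun e he => (h1 _).2 ⟨i, he⟩
    · rw [restrictSupport_eq_span, Submodule.span_le]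
      rintro _ ⟨e, he, rfl⟩
      obtain ⟨i, hi⟩ := (h1 _).1 he
      exact Submodule.mem_iSup_of_mem i ((monomial_mem_restrictSupport K).2 (.inl hi))

theorem size_pos (hM : IsExponentSet I M) (hne : M.Nonempty) (D : StanleyDecomposition I) :
    0 < D.size := by
  obtain ⟨c, h1, -⟩ := exists_boxes hM D
  obtain ⟨e, he⟩ := hne
  obtain ⟨i, -⟩ := (h1 e).1 he
  exact i.pos

theorem stanleyDecomposition_sdepth_le_card (D : StanleyDecomposition I) (i : Fin D.size) :
    D.sdepth ≤ (D.vars i).card :=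
  ciInf_le (OrderBot.bddBelow _) i

theorem bddAbove_sdepth : BddAbove {k | ∃ D : StanleyDecomposition I, D.sdepth = k} := by
  refine ⟨n, ?_⟩
  rintro _ ⟨D, rfl⟩
  rcases isEmpty_or_nonempty (Fin D.size) with h | ⟨⟨i⟩⟩
  · simp [StanleyDecomposition.sdepth, Nat.iInf_of_empty]
  · exact (stanleyDecomposition_sdepth_le_card D i).trans (card_finset_fin_le _)

/-- Nonemptiness of `M` matters: an infimum over no summands would be `0`. -/
theorem le_sdepth (hM : IsExponentSet I M) (hne : M.Nonempty) {N k : ℕ} (c : Fin N → Fin n → ℕ)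
    (Z : Fin N → Finset (Fin n)) (hZ : ∀ i, k ≤ (Z i).card)
    (h1 : ∀ e, e ∈ M ↔ ∃ i, e ∈ stanleyBox (c i, Z i))
    (h2 : ∀ i i' e, e ∈ stanleyBox (c i, Z i) → e ∈ stanleyBox (c i', Z i') → i = i') :
    k ≤ sdepth I := by
  obtain ⟨D, h, hD⟩ := exists_stanleyDecomposition hM c Z h1 h2
  have : Nonempty (Fin D.size) := ⟨⟨0, size_pos hM hne D⟩⟩
  refine le_trans ?_ (le_csSup bddAbove_sdepth ⟨D, rfl⟩)
  exact le_ciInf fun i => hD i ▸ hZ _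

theorem le_sdepth_of_boxPartition (hM : IsExponentSet I M) (hne : M.Nonempty)
    {W : Finset (Fin n)} {k : ℕ} (h : BoxPartition W k M) : k + (n - W.card) ≤ sdepth I := by
  obtain ⟨F, h1, h2, h3⟩ := h
  let g := F.equivFin.symm
  refine le_sdepth hM hne (fun i => (g i).1.1) (fun i => (g i).1.2) (fun i => ?_) (fun e => ?_)
    (fun i i' e he he' => ?_)
  · obtain ⟨h4, h5⟩ := h1 _ (g i).2
    have h6 : (g i).1.2 = ((g i).1.2 ∩ W) ∪ Wᶜ := by
      ext j
      have := h4 j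
      simp only [Finset.mem_union, Finset.mem_inter, Finset.mem_compl]
      tauto
    rw [h6, Finset.card_union_of_disjoint, Finset.card_compl, Fintype.card_fin]
    · omega
    · exact disjoint_compl_right.mono_left Finset.inter_subset_right
  · rw [h2]
    constructor
    · rintro ⟨b, hb, he⟩
      exact ⟨g.symm ⟨b, hb⟩, by simpa using he⟩
    · rintro ⟨i, hi⟩
      exact ⟨_, (g i).2, hi⟩
  · exact g.injective (Subtype.ext (h3 _ (g i).2 _ (g i').2 e he he'))

theorem sdepth_le {k : ℕ} (h : ∀ D : StanleyDecomposition I, D.sdepth ≤ k) : sdepth I ≤ k := by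
  rcases Set.eq_empty_or_nonempty {k | ∃ D : StanleyDecomposition I, D.sdepth = k} with h' | h'
  · simp [sdepth, h']
  · refine csSup_le h' ?_
    rintro _ ⟨D, rfl⟩
    exact h D

end MvPolynomial

/-! ### The upper bound by counting pairs of directions. -/

namespace MvPolynomial

variable {K : Type*} [Field K] {n : ℕ} {I : Ideal (MvPolynomial (Fin n) K)} {M : Set (Fin n → ℕ)}

/-- If `x ^ u` is not in the monomial ideal `I`, but raising any one of its exponents `u j`, `j ∈ R`,
to `α j` gives a monomial in `I`, then the Stanley depth of `I` is at most `n - ⌊|R| / 2⌋`. -/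
theorem sdepth_le_of_update_mem (hM : IsExponentSet I M) {R : Finset (Fin n)} (hR : R.Nonempty)
    {u α : Fin n → ℕ} (hu : u ∉ M) (hα : ∀ j ∈ R, u j ≤ α j)
    (hw : ∀ j ∈ R, Function.update u j (α j) ∈ M) : sdepth I ≤ n - R.card / 2 := by
  refine sdepth_le fun D => ?_
  obtain ⟨c, h1, h2⟩ := exists_boxes hM D
  obtain ⟨j₀, hj₀⟩ := hR
  have : Nonempty (Fin D.size) := ⟨((h1 _).1 (hw j₀ hj₀)).choose⟩
  choose! b hb using fun j hj => (h1 _).1 (hw j hj)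
  have hsub : ∀ j ∈ R, ∀ l ∈ R, j ≠ l → l ∈ D.vars (b j) →
      Function.update (Function.update u j (α j)) l (α l) ∈
        stanleyBox (c (b j), D.vars (b j)) := by
    intro j hj l hl hjl hlZ t
    have h3 := hb j hj t
    by_cases ht : t = l
    · subst ht
      rw [Function.update_of_ne hjl.symm] at h3
      simp only [Function.update_self]
      exact ⟨h3.1.trans (hα t hl), fun h => (h hlZ).elim⟩
    · rw [Function.update_of_ne ht]
      exact h3
  -- Otherwise the point raised in both directions lies in both boxes, so they coincide. That box
  -- then contains `u`: coordinate `j` is tested by the point raised at `l`, all others by the point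
  -- raised at `j`.
  have hexcl : ∀ j ∈ R, ∀ l ∈ R, j ≠ l → ¬ (l ∈ D.vars (b j) ∧ j ∈ D.vars (b l)) := by
    rintro j hj l hl hjl ⟨hlj, hjl'⟩
    have h3 := hsub j hj l hl hjl hlj
    have h4 := hsub l hl j hj hjl.symm hjl'
    rw [Function.update_comm hjl] at h3
    have h5 := h2 _ _ _ h3 h4
    have h6 := hb j hj
    have h7 := hb l hl
    rw [h5] at h6
    refine hu ((h1 u).2 ⟨b l, fun t => ?_⟩)
    by_cases ht : t = j
    · subst ht
      have := h7 t
      rwa [Function.update_of_ne hjl] at this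
    · have := h6 t
      rwa [Function.update_of_ne ht] at this
  by_contra hlt
  push Not at hlt
  -- At most `n - |R| + 1` free directions lie outside `R.erase j`.
  have hcard : ∀ j ∈ R, R.card - R.card / 2 ≤ ((R.erase j).filter (· ∈ D.vars (b j))).card := by
    intro j hj
    have h3 := stanleyDecomposition_sdepth_le_card D (b j)
    have h4 : D.vars (b j) ⊆ ((R.erase j).filter (· ∈ D.vars (b j))) ∪ insert j Rᶜ := by
      intro t ht
      simp only [Finset.mem_union, Finset.mem_filter, Finset.mem_erase, Finset.mem_insert,
        Finset.mem_compl]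
      tauto
    have h5 := (Finset.card_le_card h4).trans (Finset.card_union_le _ _)
    have h6 := Finset.card_insert_le j Rᶜ
    rw [Finset.card_compl, Fintype.card_fin] at h6
    have h7 := card_finset_fin_le R
    omega
  have hsum := Finset.sum_le_sum hcard
  have hswap : ∑ j ∈ R, ((R.erase j).filter (· ∈ D.vars (b j))).card =
      ∑ j ∈ R, ((R.erase j).filter fun l => j ∈ D.vars (b l)).card := by
    have h3 : ∀ j, (R.erase j).filter (· ∈ D.vars (b j)) =
        R.filter fun l => l ≠ j ∧ l ∈ D.vars (b j) := fun j => by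
      ext l; simp only [Finset.mem_filter, Finset.mem_erase]; tauto
    have h4 : ∀ j, ((R.erase j).filter fun l => j ∈ D.vars (b l)) =
        R.filter fun l => j ≠ l ∧ j ∈ D.vars (b l) := fun j => by
      ext l; simp only [Finset.mem_filter, Finset.mem_erase]; tauto
    simp only [h3, h4, Finset.card_filter]
    exact Finset.sum_comm
  -- Each ordered pair is used in at most one of its two orientations, as in a tournament.
  have htwo : ∑ j ∈ R, (((R.erase j).filter (· ∈ D.vars (b j))).card +
      ((R.erase j).filter fun l => j ∈ D.vars (b l)).card) ≤ ∑ j ∈ R, (R.card - 1) := by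
    refine Finset.sum_le_sum fun j hj => ?_
    rw [← Finset.card_union_of_disjoint, ← Finset.card_erase_of_mem hj]
    · exact Finset.card_le_card (Finset.union_subset (Finset.filter_subset _ _)
        (Finset.filter_subset _ _))
    · rw [Finset.disjoint_left]
      intro l hl hl'
      simp only [Finset.mem_filter, Finset.mem_erase] at hl hl'
      exact hexcl j hj l hl.1.2 (Ne.symm hl.1.1) ⟨hl.2, hl'.2⟩
  rw [Finset.sum_add_distrib, ← hswap] at htwo
  simp only [Finset.sum_const, smul_eq_mul] at hsum htwo
  have hpos := Finset.card_pos.2 ⟨j₀, hj₀⟩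
  have h8 : R.card * (R.card - 1) < 2 * (R.card * (R.card - R.card / 2)) := by
    rw [mul_left_comm]
    exact Nat.mul_lt_mul_of_pos_left (by omega) hpos
  omega

end MvPolynomial

/-! ### Finite certificates for the two sharpness examples. -/

/-- The condition that a box with corner `c`, unbounded in a given coordinate iff `z`, puts on this
coordinate `e` of a point. -/
def coordTest (z : Bool) (c e : ℕ) : Bool := bif z then Nat.ble c e else Nat.beq c e

/-- Membership in a box in five coordinates, as a Boolean function. -/
def boxTest (c : ℕ × ℕ × ℕ × ℕ × ℕ) (z : Bool × Bool × Bool × Bool × Bool)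
    (e : ℕ × ℕ × ℕ × ℕ × ℕ) : Bool :=
  coordTest z.1 c.1 e.1 && (coordTest z.2.1 c.2.1 e.2.1 && (coordTest z.2.2.1 c.2.2.1 e.2.2.1 &&
    (coordTest z.2.2.2.1 c.2.2.2.1 e.2.2.2.1 && coordTest z.2.2.2.2 c.2.2.2.2 e.2.2.2.2)))

/-- A function on `Fin 5` as a tuple. -/
def toTuple {α : Type*} (e : Fin 5 → α) : α × α × α × α × α := (e 0, e 1, e 2, e 3, e 4)

/-- A tuple as a function on `Fin 5`. -/
def ofTuple {α : Type*} (e : α × α × α × α × α) : Fin 5 → α :=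
  ![e.1, e.2.1, e.2.2.1, e.2.2.2.1, e.2.2.2.2]

theorem toTuple_ofTuple {α : Type*} (e : α × α × α × α × α) : toTuple (ofTuple e) = e := rfl

theorem coordTest_iff (p : Prop) [Decidable p] (c e : ℕ) :
    coordTest (decide p) c e = true ↔ c ≤ e ∧ (¬ p → e = c) := by
  by_cases h : p <;> simp [coordTest, h, Nat.ble_eq]; omega

theorem boxTest_iff (c : Fin 5 → ℕ) (Z : Finset (Fin 5)) (e : Fin 5 → ℕ) :
    boxTest (toTuple c) (toTuple fun j => decide (j ∈ Z)) (toTuple e) = true ↔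
      e ∈ stanleyBox (c, Z) := by
  simp only [boxTest, toTuple, Bool.and_eq_true, coordTest_iff, stanleyBox, Set.mem_ofPred_eq,
    Fin.forall_fin_succ, IsEmpty.forall_iff, and_true]
  rfl

/-- Exponents of monomials, with multiplicities. -/
def posWeights : List ((ℕ × ℕ × ℕ × ℕ × ℕ) × ℕ) :=
  [((0, 0, 0, 1, 1), 2), ((0, 0, 1, 0, 1), 2), ((0, 1, 0, 0, 1), 2), ((0, 0, 1, 1, 0), 3),
   ((0, 1, 0, 1, 0), 3), ((0, 1, 1, 0, 1), 2), ((0, 0, 2, 0, 0), 1), ((0, 2, 0, 0, 0), 1),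
   ((0, 1, 2, 0, 0), 3), ((0, 2, 1, 0, 0), 3), ((2, 0, 0, 0, 1), 3), ((2, 0, 0, 1, 0), 3),
   ((2, 0, 1, 0, 1), 1), ((2, 1, 0, 0, 1), 1), ((2, 1, 1, 1, 0), 1), ((2, 0, 2, 0, 0), 3),
   ((2, 2, 0, 0, 0), 3), ((2, 1, 2, 0, 0), 1), ((2, 2, 1, 0, 0), 1), ((3, 0, 0, 0, 0), 2),
   ((3, 0, 1, 0, 0), 2), ((3, 1, 0, 0, 0), 2), ((3, 1, 1, 0, 0), 2)]

/-- Exponents of monomials, with multiplicities: every box with at least three unbounded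
coordinates that is contained in
`(x_1 ^ 3, x_2 ^ 2, x_3 ^ 2, x_4, x_5) ∩ (x_1, x_2, x_3, x_4)` has at least the weight it has in
`posWeights`, although the total weight is smaller. -/
def negWeights : List ((ℕ × ℕ × ℕ × ℕ × ℕ) × ℕ) :=
  [((0, 0, 0, 1, 0), 2), ((0, 0, 1, 1, 1), 2), ((0, 1, 0, 1, 1), 2), ((0, 0, 2, 1, 0), 1),
   ((0, 2, 0, 1, 0), 1), ((0, 1, 2, 0, 1), 2), ((0, 2, 1, 0, 1), 2), ((0, 1, 2, 1, 0), 1),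
   ((0, 2, 1, 1, 0), 1), ((0, 2, 2, 0, 0), 2), ((2, 0, 0, 1, 1), 2), ((2, 1, 1, 0, 1), 1),
   ((2, 0, 2, 0, 1), 2), ((2, 2, 0, 0, 1), 2), ((2, 0, 2, 1, 0), 1), ((2, 2, 0, 1, 0), 1),
   ((2, 1, 2, 1, 0), 1), ((2, 2, 1, 1, 0), 1), ((2, 2, 2, 0, 0), 2), ((3, 0, 0, 0, 1), 1),
   ((3, 0, 0, 1, 0), 1), ((3, 0, 1, 0, 1), 1), ((3, 1, 0, 0, 1), 1), ((3, 0, 1, 1, 0), 1),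
   ((3, 1, 0, 1, 0), 1), ((3, 1, 1, 0, 1), 1), ((3, 1, 1, 1, 0), 1), ((3, 0, 2, 0, 0), 2),
   ((3, 2, 0, 0, 0), 2), ((3, 1, 2, 0, 0), 2), ((3, 2, 1, 0, 0), 2)]

/-- The total weight of the points in a box. -/
def boxWeight (L : List ((ℕ × ℕ × ℕ × ℕ × ℕ) × ℕ)) (c : ℕ × ℕ × ℕ × ℕ × ℕ)
    (z : Bool × Bool × Bool × Bool × Bool) : ℕ :=
  (L.map fun p => bif boxTest c z p.1 then p.2 else 0).sum

/-- The exponents of the monomials in `(x_1 ^ q, x_2 ^ 2, x_3 ^ r, x_4, x_5) ∩ (x_1, x_2, x_3, x_4)`,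
as a Boolean function. -/
def memTest (q r : ℕ) (e : ℕ × ℕ × ℕ × ℕ × ℕ) : Bool :=
  (Nat.ble q e.1 || (Nat.ble 2 e.2.1 || (Nat.ble r e.2.2.1 || (Nat.ble 1 e.2.2.2.1 ||
    Nat.ble 1 e.2.2.2.2)))) &&
  (Nat.ble 1 e.1 || (Nat.ble 1 e.2.1 || (Nat.ble 1 e.2.2.1 || Nat.ble 1 e.2.2.2.1)))

theorem boxWeight_le_aux :
    ((List.range 4).all fun c₀ => (List.range 3).all fun c₁ => (List.range 3).all fun c₂ =>
      (List.range 2).all fun c₃ => (List.range 2).all fun c₄ =>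
      [true, false].all fun z₀ => [true, false].all fun z₁ => [true, false].all fun z₂ =>
      [true, false].all fun z₃ => [true, false].all fun z₄ =>
      !memTest 3 2 (c₀, c₁, c₂, c₃, c₄) ||
      (Nat.blt (z₀.toNat + z₁.toNat + z₂.toNat + z₃.toNat + z₄.toNat) 3 ||
      Nat.ble (boxWeight posWeights (c₀, c₁, c₂, c₃, c₄) (z₀, z₁, z₂, z₃, z₄))
        (boxWeight negWeights (c₀, c₁, c₂, c₃, c₄) (z₀, z₁, z₂, z₃, z₄)))) = true := by
  decide +kernel

/-- A list of boxes `(c, z)` in five coordinates. -/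
def depthThreeBoxes :
    List ((ℕ × ℕ × ℕ × ℕ × ℕ) × (Bool × Bool × Bool × Bool × Bool)) :=
  [((0, 0, 0, 1, 0), (false, true, false, true, true)), ((0, 0, 1, 0, 0), (false, false, true, true, true)),
   ((0, 1, 0, 0, 1), (true, false, true, false, true)), ((0, 1, 1, 0, 0), (false, true, true, true, false)),
   ((0, 1, 1, 1, 1), (false, true, true, true, true)), ((0, 2, 0, 0, 0), (true, true, false, false, true)),
   ((0, 2, 1, 0, 1), (false, true, true, false, true)), ((1, 0, 0, 0, 1), (true, false, true, false, true)),
   ((1, 0, 0, 1, 0), (false, true, false, true, true)), ((1, 0, 1, 0, 0), (false, true, true, true, false)),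
   ((1, 0, 1, 1, 1), (false, false, true, true, true)), ((1, 1, 1, 1, 1), (true, false, true, true, true)),
   ((1, 2, 1, 0, 1), (false, true, true, false, true)), ((1, 2, 1, 1, 1), (true, true, true, true, true)),
   ((2, 0, 0, 0, 0), (true, false, true, true, false)), ((2, 0, 0, 1, 1), (true, false, false, true, true)),
   ((2, 0, 1, 1, 1), (true, false, true, true, true)), ((2, 1, 0, 0, 0), (true, false, true, true, false)),
   ((2, 1, 0, 1, 1), (true, false, false, true, true)), ((2, 2, 0, 1, 0), (true, true, false, true, false)),
   ((2, 2, 0, 1, 1), (true, true, false, true, true)), ((2, 2, 1, 0, 0), (true, true, true, false, false)),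
   ((2, 2, 1, 0, 1), (true, true, true, false, true)), ((2, 2, 1, 1, 0), (true, true, true, true, false))]

/-- Whether two boxes are disjoint because of their projections to a coordinate. -/
def coordDisjoint (z z' : Bool) (c c' : ℕ) : Bool :=
  (!z && Nat.blt c c') || (!z' && Nat.blt c' c)

/-- Whether the corner of a box is at most `g`, and less than `g` where the box is bounded. -/
def coordCapped (z : Bool) (c g : ℕ) : Bool := bif z then Nat.ble c g else Nat.blt c g

theorem depthThreeBoxes_disjoint :
    depthThreeBoxes.Pairwise fun b b' =>
      (coordDisjoint b.2.1 b'.2.1 b.1.1 b'.1.1 || (coordDisjoint b.2.2.1 b'.2.2.1 b.1.2.1 b'.1.2.1 ||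
      (coordDisjoint b.2.2.2.1 b'.2.2.2.1 b.1.2.2.1 b'.1.2.2.1 ||
      (coordDisjoint b.2.2.2.2.1 b'.2.2.2.2.1 b.1.2.2.2.1 b'.1.2.2.2.1 ||
      coordDisjoint b.2.2.2.2.2 b'.2.2.2.2.2 b.1.2.2.2.2 b'.1.2.2.2.2)))) = true := by
  decide +kernel

theorem depthThreeBoxes_capped :
    ∀ b ∈ depthThreeBoxes,
      (coordCapped b.2.1 b.1.1 2 && (coordCapped b.2.2.1 b.1.2.1 2 &&
      (coordCapped b.2.2.2.1 b.1.2.2.1 1 && (coordCapped b.2.2.2.2.1 b.1.2.2.2.1 1 &&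
      coordCapped b.2.2.2.2.2 b.1.2.2.2.2 1)))) = true := by
  decide +kernel

theorem depthThreeBoxes_cover :
    ∀ e₀ < 3, ∀ e₁ < 3, ∀ e₂ < 2, ∀ e₃ < 2, ∀ e₄ < 2,
      memTest 2 1 (e₀, e₁, e₂, e₃, e₄) =
        depthThreeBoxes.any fun b => boxTest b.1 b.2 (e₀, e₁, e₂, e₃, e₄) := by
  decide +kernel

theorem depthThreeBoxes_card :
    ∀ b ∈ depthThreeBoxes,
      3 ≤ (Finset.univ.filter fun j => ofTuple b.2 j = true).card := by
  decide +kernel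

/-- The finite check suffices: a corner exceeding `(3, 2, 2, 1, 1)` somewhere yields a box missing
every point of `posWeights`. -/
theorem boxWeight_le {c : Fin 5 → ℕ} {Z : Finset (Fin 5)} (hZ : 3 ≤ Z.card)
    (hc : memTest 3 2 (toTuple c) = true) :
    boxWeight posWeights (toTuple c) (toTuple fun j => decide (j ∈ Z)) ≤
      boxWeight negWeights (toTuple c) (toTuple fun j => decide (j ∈ Z)) := by
  have hZ' : Z.card = (decide (0 ∈ Z)).toNat + (decide (1 ∈ Z)).toNat + (decide (2 ∈ Z)).toNat +
      (decide (3 ∈ Z)).toNat + (decide (4 ∈ Z)).toNat := by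
    have : Z.card = ∑ j, (decide (j ∈ Z)).toNat := by
      rw [← Finset.filter_univ_mem Z, Finset.card_filter]
      refine Finset.sum_congr rfl fun j _ => ?_
      by_cases h : j ∈ Z <;> simp [h]
    rw [this, Fin.sum_univ_five]
  by_cases hle : c 0 < 4 ∧ c 1 < 3 ∧ c 2 < 3 ∧ c 3 < 2 ∧ c 4 < 2
  · obtain ⟨h0, h1, h2, h3, h4⟩ := hle
    have h := boxWeight_le_aux
    simp only [List.all_eq_true, List.mem_range] at h
    have hb : ∀ z : Bool, z ∈ [true, false] := by decide
    have h5 := h (c 0) h0 (c 1) h1 (c 2) h2 (c 3) h3 (c 4) h4 _ (hb (decide (0 ∈ Z)))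
      _ (hb (decide (1 ∈ Z))) _ (hb (decide (2 ∈ Z))) _ (hb (decide (3 ∈ Z)))
      _ (hb (decide (4 ∈ Z)))
    rw [← hZ'] at h5
    rw [toTuple] at hc
    have h6 : Nat.blt Z.card 3 = false := by
      rw [Bool.eq_false_iff]
      intro h
      have : Z.card < 3 := Nat.ble_eq.mp h
      omega
    rw [hc, h6] at h5
    simp only [Bool.not_true, Bool.false_or, Nat.ble_eq] at h5
    exact h5
  · have h0 : boxWeight posWeights (toTuple c) (toTuple fun j => decide (j ∈ Z)) = 0 := by
      rw [boxWeight, List.sum_eq_zero_iff_forall_eq_nat]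
      simp only [List.mem_map]
      rintro _ ⟨p, hp, rfl⟩
      have hp' : ∀ p ∈ posWeights, p.1.1 < 4 ∧ p.1.2.1 < 3 ∧ p.1.2.2.1 < 3 ∧ p.1.2.2.2.1 < 2 ∧
          p.1.2.2.2.2 < 2 := by decide +kernel
      obtain ⟨h0, h1, h2, h3, h4⟩ := hp' p hp
      have : boxTest (toTuple c) (toTuple fun j => decide (j ∈ Z)) p.1 = false := by
        rw [Bool.eq_false_iff]
        intro h
        rw [← toTuple_ofTuple p.1, boxTest_iff] at h
        refine hle ⟨(h 0).1.trans_lt h0, (h 1).1.trans_lt h1, (h 2).1.trans_lt h2,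
          (h 3).1.trans_lt h3, (h 4).1.trans_lt h4⟩
      simp [this]
    rw [h0]
    exact Nat.zero_le _

/-! ### The two examples. -/

namespace MvPolynomial

variable {K : Type*} [Field K]

theorem memTest_iff (q r : ℕ) (e : Fin 5 → ℕ) : memTest q r (toTuple e) = true ↔
    e ∈ {e : Fin 5 → ℕ | ∀ l : Fin 2, 0 ≤ l → ∃ j : Fin 5, (j : ℕ) < (![5, 4] : Fin 2 → ℕ) l ∧
      (![![q, 2, r, 1, 1], ![1, 1, 1, 1, 1]] : Fin 2 → Fin 5 → ℕ) l j ≤ e j} := by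
  simp [memTest, toTuple, Fin.forall_fin_two, Fin.exists_fin_succ]

/-- If all boxes had three free directions, summing their weights would bound the total of
`posWeights` (points covered at least once) by that of `negWeights` (points covered at most once),
but the former is larger. -/
theorem sdepth_fst_le : sdepth (tailIdeal K (n := 5) (m := 1) ![5, 4]
    ![![3, 2, 2, 1, 1], ![1, 1, 1, 1, 1]] 0) ≤ 2 := by
  refine sdepth_le fun D => ?_
  by_contra! hD
  obtain ⟨c, h1, h2⟩ := exists_boxes (isExponentSet_tailIdeal _ _ _) D
  simp only [← memTest_iff] at h1
  let z : Fin D.size → Bool × Bool × Bool × Bool × Bool :=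
    fun i => toTuple fun j => decide (j ∈ D.vars i)
  have htest : ∀ i e, boxTest (toTuple (c i)) (z i) e = true ↔
      ofTuple e ∈ stanleyBox (c i, D.vars i) := fun i e => by
    rw [← boxTest_iff, toTuple_ofTuple]
  have hsplit : ∀ L, boxWeight L = fun (c : ℕ × ℕ × ℕ × ℕ × ℕ) z =>
    (L.map fun p => bif boxTest c z p.1 then p.2 else 0).sum := fun L => rfl
  have hpos : ∀ L : List ((ℕ × ℕ × ℕ × ℕ × ℕ) × ℕ), (∀ p ∈ L, memTest 3 2 p.1 = true) →
      (L.map Prod.snd).sum ≤ ∑ i, boxWeight L (toTuple (c i)) (z i) := by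
    intro L hL
    induction L with
    | nil => simp
    | cons p L ih =>
      simp only [hsplit, List.map_cons, List.sum_cons, Finset.sum_add_distrib]
      refine add_le_add ?_ (ih fun q hq => hL q (List.mem_cons_of_mem _ hq))
      obtain ⟨i, hi⟩ := (h1 (ofTuple p.1)).1 (hL p List.mem_cons_self)
      refine le_trans ?_ (Finset.single_le_sum (fun _ _ => Nat.zero_le _) (Finset.mem_univ i))
      simp [(htest i p.1).2 hi]
  have hneg : ∀ L : List ((ℕ × ℕ × ℕ × ℕ × ℕ) × ℕ),
      ∑ i, boxWeight L (toTuple (c i)) (z i) ≤ (L.map Prod.snd).sum := by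
    intro L
    induction L with
    | nil => simp [boxWeight]
    | cons p L ih =>
      simp only [hsplit, List.map_cons, List.sum_cons, Finset.sum_add_distrib] at ih ⊢
      refine add_le_add ?_ ih
      by_cases h : ∃ i, boxTest (toTuple (c i)) (z i) p.1 = true
      · obtain ⟨i, hi⟩ := h
        rw [Finset.sum_eq_single i]
        · simp [hi]
        · intro i' _ hne
          have : boxTest (toTuple (c i')) (z i') p.1 = false := by
            rw [Bool.eq_false_iff]
            intro h'
            exact hne (h2 _ _ _ ((htest _ _).1 h') ((htest _ _).1 hi))
          simp [this]
        · simp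
      · push Not at h
        simp [h]
  have hle : ∀ i, boxWeight posWeights (toTuple (c i)) (z i) ≤
      boxWeight negWeights (toTuple (c i)) (z i) := fun i =>
    boxWeight_le (hD.trans_le (stanleyDecomposition_sdepth_le_card D i))
      ((h1 (c i)).2 ⟨i, fun j => ⟨le_rfl, fun _ => rfl⟩⟩)
  have h3 := (hpos posWeights (by decide +kernel)).trans
    ((Finset.sum_le_sum fun i _ => hle i).trans (hneg negWeights))
  exact absurd h3 (by decide +kernel)

/-- Truncation at `g` is harmless because a bounded coordinate has its corner strictly below `g`.
This reduces covering of `ℕ^5` to a finite grid. -/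
theorem coordTest_min {z : Bool} {c g : ℕ} (h : coordCapped z c g = true) (e : ℕ) :
    coordTest z c (min e g) = coordTest z c e := by
  cases z
  · have h : c < g := Nat.ble_eq.mp h
    simp only [coordTest, cond_false]
    rw [Bool.eq_iff_iff, Nat.beq_eq, Nat.beq_eq]
    omega
  · have h : c ≤ g := Nat.ble_eq.mp h
    simp only [coordTest, cond_true]
    rw [Bool.eq_iff_iff, Nat.ble_eq, Nat.ble_eq]
    omega

theorem not_coordTest_of_coordDisjoint {z z' : Bool} {c c' e : ℕ}
    (h : coordDisjoint z z' c c' = true) (h1 : coordTest z c e = true)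
    (h2 : coordTest z' c' e = true) : False := by
  cases z <;> cases z' <;>
    simp [coordDisjoint, coordTest, Nat.blt, Nat.ble_eq, Nat.beq_eq] at h h1 h2 <;> omega

theorem le_sdepth_snd : 3 ≤ sdepth (tailIdeal K (n := 5) (m := 1) ![5, 4]
    ![![2, 2, 1, 1, 1], ![1, 1, 1, 1, 1]] 0) := by
  let c : Fin depthThreeBoxes.length → Fin 5 → ℕ := fun i => ofTuple (depthThreeBoxes.get i).1
  let Z : Fin depthThreeBoxes.length → Finset (Fin 5) := fun i =>
    Finset.univ.filter fun j => ofTuple (depthThreeBoxes.get i).2 j = true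
  have htest : ∀ i e, e ∈ stanleyBox (c i, Z i) ↔
      boxTest (depthThreeBoxes.get i).1 (depthThreeBoxes.get i).2 (toTuple e) = true := by
    intro i e
    have h : (toTuple fun j => decide (j ∈ Z i)) = (depthThreeBoxes.get i).2 := by
      simp only [Z, Finset.mem_filter, Finset.mem_univ, true_and, Bool.decide_eq_true]
      exact toTuple_ofTuple _
    rw [← boxTest_iff, h, toTuple_ofTuple]
  refine le_sdepth (isExponentSet_tailIdeal _ _ _) ⟨fun _ => 2, ?_⟩ c Z
    (fun i => depthThreeBoxes_card _ (List.get_mem _ _)) (fun e => ?_) (fun i i' e he he' => ?_)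
  · rw [← memTest_iff]
    decide
  · rw [← memTest_iff]
    simp only [htest]
    have h1 : memTest 2 1 (toTuple e) =
        memTest 2 1 (min (e 0) 2, min (e 1) 2, min (e 2) 1, min (e 3) 1, min (e 4) 1) := by
      have hmin : ∀ k g x, k ≤ g → Nat.ble k (min x g) = Nat.ble k x := fun k g x h => by
        rw [Bool.eq_iff_iff, Nat.ble_eq, Nat.ble_eq]
        omega
      simp only [memTest, toTuple]
      rw [hmin, hmin, hmin, hmin, hmin, hmin, hmin] <;> norm_num
    rw [h1, depthThreeBoxes_cover _ (by omega) _ (by omega) _ (by omega) _ (by omega) _ (by omega),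
      List.any_eq_true]
    have h2 : ∀ b ∈ depthThreeBoxes, boxTest b.1 b.2
        (min (e 0) 2, min (e 1) 2, min (e 2) 1, min (e 3) 1, min (e 4) 1) =
        boxTest b.1 b.2 (toTuple e) := by
      intro b hb
      have h3 := depthThreeBoxes_capped b hb
      simp only [Bool.and_eq_true] at h3
      obtain ⟨h3, h4, h5, h6, h7⟩ := h3
      simp only [boxTest, toTuple, coordTest_min h3, coordTest_min h4, coordTest_min h5,
        coordTest_min h6, coordTest_min h7]
    constructor
    · rintro ⟨b, hb, h⟩
      obtain ⟨i, rfl⟩ := List.get_of_mem hb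
      exact ⟨i, h2 _ hb ▸ h⟩
    · rintro ⟨i, h⟩
      exact ⟨_, List.get_mem _ _, (h2 _ (List.get_mem _ i)).trans h⟩
  · rw [htest] at he he'
    simp only [boxTest, Bool.and_eq_true] at he he'
    obtain ⟨a0, a1, a2, a3, a4⟩ := he
    obtain ⟨b0, b1, b2, b3, b4⟩ := he'
    have hd := List.pairwise_iff_get.1 depthThreeBoxes_disjoint
    simp only [Bool.or_eq_true] at hd
    rcases lt_trichotomy i i' with h | h | h
    · rcases hd _ _ h with h | h | h | h | h
      exacts [(not_coordTest_of_coordDisjoint h a0 b0).elim,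
        (not_coordTest_of_coordDisjoint h a1 b1).elim,
        (not_coordTest_of_coordDisjoint h a2 b2).elim,
        (not_coordTest_of_coordDisjoint h a3 b3).elim,
        (not_coordTest_of_coordDisjoint h a4 b4).elim]
    · exact h
    · rcases hd _ _ h with h | h | h | h | h
      exacts [(not_coordTest_of_coordDisjoint h b0 a0).elim,
        (not_coordTest_of_coordDisjoint h b1 a1).elim,
        (not_coordTest_of_coordDisjoint h b2 a2).elim,
        (not_coordTest_of_coordDisjoint h b3 a3).elim,
        (not_coordTest_of_coordDisjoint h b4 a4).elim]

end MvPolynomial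

/-! ### The bounds for the tail ideals. -/

namespace MvPolynomial

variable {K : Type*} [Field K] {n m : ℕ} {ν : Fin (m + 1) → ℕ} {a : Fin (m + 1) → Fin n → ℕ}

theorem le_sdepth_tailIdeal (hn : ν 0 ≤ n) (hν : StrictAnti ν) (hm : 1 ≤ ν (Fin.last m))
    (ha : ∀ i : Fin m, ∀ j : Fin n, (j : ℕ) < ν i.succ → a i.succ j ≤ a i.castSucc j)
    (i : Fin (m + 1)) : (ν (Fin.last m) + 1) / 2 + (n - ν i) ≤ sdepth (tailIdeal K ν a i) := by
  have hνn : ∀ l, ν l ≤ n := fun l => (hν.antitone (Fin.zero_le l)).trans hn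
  have hν1 : ∀ l, 1 ≤ ν l := fun l => hm.trans (hν.antitone (Fin.le_last l))
  -- The chain is reindexed to start at `i`; the clamp at `m` only makes the index total.
  let idx : ℕ → Fin (m + 1) := fun t => ⟨min (i + t) m, by omega⟩
  let W : ℕ → Finset (Fin n) := fun t => Finset.univ.filter fun j => (j : ℕ) < ν (idx t)
  have hcard : ∀ t, (W t).card = ν (idx t) := fun t => by
    rw [Fin.card_filter_val_lt, min_eq_right (hνn _)]
  have hmem : ∀ t j, j ∈ W t ↔ (j : ℕ) < ν (idx t) := by simp [W]
  have hstep : ∀ t < m - i, ∃ s : Fin m, idx t = s.castSucc ∧ idx (t + 1) = s.succ := fun t ht =>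
    ⟨⟨i + t, by omega⟩, Fin.ext (by simp [idx]; omega), Fin.ext (by simp [idx]; omega)⟩
  have h := BoxPartition.chain (m - i) W (fun t => a (idx t))
    (fun t ht j hj => by
      obtain ⟨s, h1, h2⟩ := hstep t ht
      rw [hmem, h2] at hj
      rw [hmem, h1]
      exact hj.trans (hν Fin.castSucc_lt_succ))
    (fun t ht j hj => by
      obtain ⟨s, h1, h2⟩ := hstep t ht
      rw [hmem, h2] at hj
      rw [h1, h2]
      exact ha s j hj)
  have hidx0 : idx 0 = i := Fin.ext (by simp [idx]; omega)
  have hidxm : idx (m - i) = Fin.last m := Fin.ext (by simp [idx]; omega)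
  have hM : {e : Fin n → ℕ | ∀ t ≤ m - (i : ℕ), ∃ j ∈ W t, a (idx t) j ≤ e j} =
      {e | ∀ l, i ≤ l → ∃ j : Fin n, (j : ℕ) < ν l ∧ a l j ≤ e j} := by
    ext e
    simp only [Set.mem_ofPred_eq, hmem]
    constructor
    · intro h l hl
      have hl' : (i : ℕ) ≤ l := hl
      have h1 : idx (l - i) = l := Fin.ext (by simp [idx]; omega)
      have h2 := h (l - i) (by omega)
      rwa [h1] at h2
    · intro h t _
      refine h (idx t) ?_
      change (i : ℕ) ≤ min (i + t) m
      omega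
  rw [hM] at h
  have h1 := le_sdepth_of_boxPartition (K := K) (isExponentSet_tailIdeal ν a i) ?_ h
  · rwa [hcard, hcard, hidx0, hidxm] at h1
  · refine ⟨fun j => ∑ l, a l j, fun l _ => ⟨⟨0, ?_⟩, ?_, ?_⟩⟩
    · exact Nat.lt_of_lt_of_le (hν1 0) hn
    · exact hν1 l
    · exact Finset.single_le_sum (f := fun l => a l _) (fun _ _ => Nat.zero_le _)
        (Finset.mem_univ l)

theorem sdepth_tailIdeal_le (hνn : ∀ l, ν l ≤ n) (i : Fin (m + 1)) (hi : 1 ≤ ν i)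
    (hirr : ¬ ((⨅ j, ⨅ (_ : j ≠ i), powerIdeal K (ν j) (a j)) ≤ powerIdeal K (ν i) (a i))) :
    sdepth (tailIdeal K ν a i) ≤ n - ν i / 2 := by
  rw [SetLike.not_le_iff_exists] at hirr
  obtain ⟨p, hp, hp'⟩ := hirr
  rw [isExponentSet_iInf fun l => isExponentSet_powerIdeal (ν l) (a l)] at hp
  rw [isExponentSet_powerIdeal] at hp'
  push Not at hp'
  obtain ⟨u, hu, hu'⟩ := hp'
  have hu1 := hp u hu
  simp only [Set.mem_ofPred_eq, not_exists, not_and, not_le] at hu1 hu'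
  have hcard : (Finset.univ.filter fun j : Fin n => (j : ℕ) < ν i).card = ν i := by
    rw [Fin.card_filter_val_lt, min_eq_right (hνn _)]
  have h := sdepth_le_of_update_mem (K := K) (isExponentSet_tailIdeal ν a i)
    (R := Finset.univ.filter fun j : Fin n => (j : ℕ) < ν i) (u := u) (α := a i)
    (Finset.card_pos.1 (by omega)) ?_ ?_ ?_
  · rwa [hcard] at h
  · intro h
    obtain ⟨j, hj, hj'⟩ := h i le_rfl
    exact absurd hj' (not_le.2 (hu' j hj))
  · exact fun j hj => (hu' j (Finset.mem_filter.1 hj).2).le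
  -- Raising `u` keeps it in every `Q_l` with `l ≠ i`, and the new exponent at `j` puts it in `Q_i`.
  · intro j hj l _
    have hj := (Finset.mem_filter.1 hj).2
    by_cases hl : l = i
    · subst hl
      exact ⟨j, hj, by simp⟩
    · obtain ⟨t, ht, ht'⟩ := hu1 l hl
      refine ⟨t, ht, ht'.trans ?_⟩
      by_cases htj : t = j
      · subst htj
        simpa using (hu' t hj).le
      · rw [Function.update_of_ne htj]

theorem tailIdeal_bounds (hn : ν 0 ≤ n) (hν : StrictAnti ν) (hm : 1 ≤ ν (Fin.last m))
    (ha : ∀ i : Fin m, ∀ j : Fin n, (j : ℕ) < ν i.succ → a i.succ j ≤ a i.castSucc j)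
    (i : Fin (m + 1)) :
    (n : ℤ) + ⌈(ν (Fin.last m) : ℚ) / 2⌉ - ν i ≤ (sdepth (tailIdeal K ν a i) : ℤ) ∧
      (¬ ((⨅ j, ⨅ (_ : j ≠ i), powerIdeal K (ν j) (a j)) ≤ powerIdeal K (ν i) (a i)) →
        (sdepth (tailIdeal K ν a i) : ℤ) ≤ (n : ℤ) - ⌊(ν i : ℚ) / 2⌋) := by
  have hνn : ∀ l, ν l ≤ n := fun l => (hν.antitone (Fin.zero_le l)).trans hn
  have hi := hνn i
  constructor
  · have h1 := le_sdepth_tailIdeal (K := K) hn hν hm ha i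
    have h2 : ⌈(ν (Fin.last m) : ℚ) / 2⌉ ≤ (((ν (Fin.last m) + 1) / 2 : ℕ) : ℤ) := by
      rw [Int.ceil_le]
      have h3 : ν (Fin.last m) ≤ 2 * ((ν (Fin.last m) + 1) / 2) := by omega
      have h4 : (ν (Fin.last m) : ℚ) ≤ 2 * (((ν (Fin.last m) + 1) / 2 : ℕ) : ℚ) := by
        exact_mod_cast h3
      rw [Int.cast_natCast]
      linarith
    omega
  · intro hirr
    have h1 := sdepth_tailIdeal_le hνn i (hm.trans (hν.antitone (Fin.le_last i))) hirr
    have h2 : ⌊(ν i : ℚ) / 2⌋ < ((ν i / 2 + 1 : ℕ) : ℤ) := by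
      rw [Int.floor_lt]
      have h3 : ν i < 2 * (ν i / 2 + 1) := by omega
      have h4 : (ν i : ℚ) < 2 * ((ν i / 2 + 1 : ℕ) : ℚ) := by exact_mod_cast h3
      rw [Int.cast_natCast]
      linarith
    omega

end MvPolynomial

theorem theorem1p6 (K : Type*) [Field K] :
    (∀ (n m : ℕ) (ν : Fin (m + 1) → ℕ) (a : Fin (m + 1) → Fin n → ℕ),
      ν 0 ≤ n → StrictAnti ν → 1 ≤ ν (Fin.last m) →
      (∀ i, ∀ j : Fin n, (j : ℕ) < ν i → 0 < a i j) →
      (∀ i : Fin m, ∀ j : Fin n, (j : ℕ) < ν i.succ → a i.succ j ≤ a i.castSucc j) →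
      ∀ i : Fin (m + 1),
        -- the lower bound
        (n : ℤ) + ⌈(ν (Fin.last m) : ℚ) / 2⌉ - ν i ≤ (sdepth (tailIdeal K ν a i) : ℤ) ∧
        -- the upper bound, when `Q_i` is not redundant in `Q_0 ∩ … ∩ Q_m`
        (¬ ((⨅ j, ⨅ (_ : j ≠ i), powerIdeal K (ν j) (a j)) ≤ powerIdeal K (ν i) (a i)) →
          (sdepth (tailIdeal K ν a i) : ℤ) ≤ (n : ℤ) - ⌊(ν i : ℚ) / 2⌋)) ∧
    -- the lower bound is attained: `n = n_0 = 5`, `n_1 = 4`, and `2 = 5 + ⌈4 / 2⌉ - 5`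
    sdepth (tailIdeal K (n := 5) (m := 1) ![5, 4] ![![3, 2, 2, 1, 1], ![1, 1, 1, 1, 1]] 0) = 2 ∧
    -- the upper bound is attained: `n = n_0 = 5`, `n_1 = 4`, and `3 = 5 - ⌊5 / 2⌋`
    sdepth (tailIdeal K (n := 5) (m := 1) ![5, 4] ![![2, 2, 1, 1, 1], ![1, 1, 1, 1, 1]] 0) = 3 := by
  refine ⟨fun n m ν a hn hν hm _ ha i => MvPolynomial.tailIdeal_bounds hn hν hm ha i, ?_, ?_⟩
  · refine le_antisymm MvPolynomial.sdepth_fst_le ?_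
    exact MvPolynomial.le_sdepth_tailIdeal (K := K) (n := 5) (m := 1) (ν := ![5, 4])
      (a := ![![3, 2, 2, 1, 1], ![1, 1, 1, 1, 1]]) le_rfl (by decide) (by decide) (by decide) 0
  · refine le_antisymm ?_ MvPolynomial.le_sdepth_snd
    refine MvPolynomial.sdepth_tailIdeal_le (K := K) (n := 5) (m := 1) (ν := ![5, 4])
      (a := ![![2, 2, 1, 1, 1], ![1, 1, 1, 1, 1]]) (by decide) 0 (by decide) fun h => ?_
    -- The first variable witnesses irredundance: it lies in `Q_1`, while `Q_0` contains only its
    -- square.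
    have h1 : (MvPolynomial.X 0 : MvPolynomial (Fin 5) K) ∈
        ⨅ j, ⨅ (_ : j ≠ (0 : Fin 2)), powerIdeal K ((![5, 4] : Fin 2 → ℕ) j)
          ((![![2, 2, 1, 1, 1], ![1, 1, 1, 1, 1]] : Fin 2 → Fin 5 → ℕ) j) := by
      simp only [Submodule.mem_iInf]
      intro j hj
      obtain rfl : j = 1 := by omega
      exact Ideal.subset_span ⟨0, by decide, by simp⟩
    have h2 := h h1
    rw [MvPolynomial.isExponentSet_powerIdeal] at h2
    have h3 := h2 (Finsupp.single 0 1) (by simp [MvPolynomial.support_X])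
    simp [Fin.exists_fin_succ] at h3
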